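/- \textbf{Proposition (Control Fisher (III)).} Let $p_0^0,p_0^1\in \mathrm{C}^1(\mathbb{R}^d,\mathbb{R})$ be two probability densities with respect to the Lebesgue measure. For $i\in\{0,1\}$ and $t\in(0,1]$ let $p_t^i$ be the (smooth) density of $X_t^i=\alpha_tX_0^i+\sigma_tZ$, where $\alpha_t=1-t$, $\sigma_t=t$, $X_0^i$ has density $p_0^i$ and $Z\sim\mathcal N(0,\mathrm{Id})$ is independent of $X_0^i$. Let $p_{t|0}(\cdot|x_0)$ be the density of $\mathcal N(\alpha_tx_0,\sigma_t^2\mathrm{Id})$ and let $p^i_{0|t}(x_0|x_t)=p_{t|0}(x_t|x_0)p^i_0(x_0)/p^i_t(x_t)$ be the posterior density of $X^i_0$ given $X^i_t=x_t$. The score $\nabla\log p$ is $\nabla p/p$ where $p>0$ and is set to $0$ where $p=0$. For probability densities $p,q$ and $\alpha>1$ put, with values in $[0,\infty]$, $$\mathrm{FI}(p|q)=\int_{\mathbb{R}^d}\|\nabla\log p-\nabla\log q\|^2\,p\,\mathrm dx,\qquad \chi_\alpha(p|q)=\int_{\mathbb{R}^d}\Bigl|1-\frac pq\Bigr|^\alpha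 q\,\mathrm dx,$$ where the integrand of $\chi_\alpha$ is $+\infty$ where $q=0<p$ and $0$ where $p=q=0$. Assume that for $i\in\{0,1\}$ 1. $\int\|\nabla\log p_0^i(x_0)\|\,p_{0|t}^i(x_0|x_t)\,\mathrm dx_0<+\infty$ for all $t\in(0,1]$ and $x_t\in\mathbb{R}^d$; 2. $D_4^i=\int\|\nabla\log p_0^i(x_0)\|^4\,p_0^0(x_0)\,\mathrm dx_0<+\infty$; 3. $C_4^i=\int\|x\|^4\,p_0^i(x)\,\mathrm dx<+\infty$; and that $\chi_2(p_0^0|p_0^1)<+\infty$. Then there is a finite constant $C\ge 0$ such that for all $t\in(0,1)$ $$\mathrm{FI}(p_t^0|p_t^1)\le C\min\Bigl(\bigl(\tfrac1{\sigma_t}-\sigma_t\bigr)^2+\alpha_t^2,\ \tfrac1{\alpha_t^2}\bigl(\mathrm{FI}(p_0^0|p_0^1)+\chi_{16}(p_0^1|p_0^0)^{1/8}+\chi_{16}(p_0^0|p_0^1)^{1/8}\bigr)\Bigr).$$ The constant $C$ depends on nothing but $d$ and an upper bound $M<\infty$ for $C_4^0$, $C_4^1$, $D_4^0$, $D_4^1$,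 $\chi_2(p_0^0|p_0^1)$ and, if it is finite, $\chi_8(p_0^1|p_0^0)$ (if $\chi_8(p_0^1|p_0^0)=+\infty$, the second term of the minimum is $+\infty$). In particular $C$ does not depend on $t$. -/

import Mathlib

open MeasureTheory ProbabilityTheory Set
open scoped ENNReal NNReal

noncomputable section

namespace Noising

/-- The space `ℝ^d` with its Euclidean norm and Lebesgue measure. -/
abbrev E (d : ℕ) : Type := EuclideanSpace ℝ (Fin d)

/-- `p` is a probability density with respect to the Lebesgue measure on `ℝ^d`. -/
structure IsProbDensity {d : ℕ} (p : E d → ℝ) : Prop where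
  measurable : Measurable p
  nonneg : ∀ x, 0 ≤ p x
  lintegral_eq_one : ∫⁻ x, ENNReal.ofReal (p x) = 1

/-- The probability measure `p(x) dx`. -/
def densityMeasure {d : ℕ} (p : E d → ℝ) : Measure (E d) :=
  volume.withDensity fun x => ENNReal.ofReal (p x)

/-- The score `∇ log p`. It is `∇p / p` where `p > 0` is differentiable. With the conventions
`Real.log 0 = 0` and gradient `0` where the function is not differentiable, it vanishes at every
zero of a continuous nonnegative `p`. -/
def score {d : ℕ} (p : E d → ℝ) (x : E d) : E d :=
  gradient (fun y => Real.log (p y)) x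

/-- The density at `x` of the Gaussian law `N(m, s² Id)` on `ℝ^d`, for `s > 0`. -/
def gaussianDensity {d : ℕ} (m : E d) (s : ℝ) (x : E d) : ℝ :=
  ((2 * Real.pi * s ^ 2) ^ ((d : ℝ) / 2))⁻¹ * Real.exp (-‖x - m‖ ^ 2 / (2 * s ^ 2))

/-- The law of `X_t = (1 - t) X_0 + t Z`, where `X_0` has density `p` and `Z` is an independent
standard Gaussian vector. -/
def noisedLaw {d : ℕ} (t : ℝ) (p : E d → ℝ) : Measure (E d) :=
  ((densityMeasure p).prod (stdGaussian (E d))).map fun y => (1 - t) • y.1 + t • y.2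

/-- The transition density `p_{t|0}(x | x₀)`: the density at `x` of `N((1 - t) x₀, t² Id)`. -/
def transitionDensity {d : ℕ} (t : ℝ) (x x₀ : E d) : ℝ :=
  gaussianDensity ((1 - t) • x₀) t x

/-- The density `p_t` of `X_t`, for `t ∈ (0, 1]`, when `X_0` has density `p`
(see `noisedLaw_eq` below). This is its everywhere defined, smooth version. -/
def marginalDensity {d : ℕ} (t : ℝ) (p : E d → ℝ) (x : E d) : ℝ :=
  ∫ x₀, transitionDensity t x x₀ * p x₀

/-- The posterior density `p_{0|t}(x₀ | x)` of `X_0` given `X_t = x`, for `t ∈ (0, 1]`. -/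
def posteriorDensity {d : ℕ} (t : ℝ) (p : E d → ℝ) (x₀ x : E d) : ℝ :=
  transitionDensity t x x₀ * p x₀ / marginalDensity t p x

/-- The relative Fisher information `FI(p | q) = ∫ ‖∇ log p - ∇ log q‖² p`, in `[0, ∞]`. -/
def fisherInfo {d : ℕ} (p q : E d → ℝ) : ℝ≥0∞ :=
  ∫⁻ x, ‖score p x - score q x‖ₑ ^ 2 * ENNReal.ofReal (p x)

open Classical in
/-- The divergence `χ_α(p | q) = ∫ |1 - p/q|^α q`, in `[0, ∞]`, for `α > 1`. As usual for
`f`-divergences of superlinear growth, the integrand is `∞` where `q = 0 < p` and `0` where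
`p = q = 0`. -/
def chiDiv {d : ℕ} (α : ℝ) (p q : E d → ℝ) : ℝ≥0∞ :=
  ∫⁻ x, if q x = 0 then (if p x = 0 then 0 else ∞)
    else ENNReal.ofReal (|1 - p x / q x| ^ α * q x)

/-- The moment `∫ ‖x‖^k p(x) dx`, in `[0, ∞]`. -/
def moment {d : ℕ} (k : ℕ) (p : E d → ℝ) : ℝ≥0∞ :=
  ∫⁻ x, ‖x‖ₑ ^ k * ENNReal.ofReal (p x)

/-- The moment of the score `∫ ‖∇ log p(x)‖^k r(x) dx` under the density `r`, in `[0, ∞]`. -/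
def scoreMoment {d : ℕ} (k : ℕ) (p r : E d → ℝ) : ℝ≥0∞ :=
  ∫⁻ x, ‖score p x‖ₑ ^ k * ENNReal.ofReal (r x)

/-! The function `marginalDensity t p` is indeed a density of the law of `X_t`. -/

theorem gaussianDensity_nonneg {d : ℕ} (m : E d) (s : ℝ) (x : E d) :
    0 ≤ gaussianDensity m s x := by
  unfold gaussianDensity; positivity

theorem continuous_gaussianDensity {d : ℕ} (s : ℝ) :
    Continuous fun y : E d × E d => gaussianDensity y.1 s y.2 := by
  unfold gaussianDensity; fun_prop

theorem gaussianDensity_le {d : ℕ} (m : E d) (s : ℝ) (x : E d) :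
    gaussianDensity m s x ≤ ((2 * Real.pi * s ^ 2) ^ ((d : ℝ) / 2))⁻¹ := by
  unfold gaussianDensity
  refine mul_le_of_le_one_right (by positivity) (Real.exp_le_one_iff.2 ?_)
  exact div_nonpos_of_nonpos_of_nonneg (by simp) (by positivity)

theorem integrable_gaussianDensity {d : ℕ} (m : E d) {s : ℝ} (hs : 0 < s) :
    Integrable (gaussianDensity m s) := by
  have h := (GaussianFourier.integrable_cexp_neg_mul_sq_norm_add (V := E d)
    (b := ((1 / (2 * s ^ 2) : ℝ) : ℂ)) (by rw [Complex.ofReal_re]; positivity) 0 0).norm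
  have h2 := (h.comp_sub_right m).const_mul (((2 * Real.pi * s ^ 2) ^ ((d : ℝ) / 2))⁻¹)
  refine h2.congr (Filter.Eventually.of_forall fun x => ?_)
  simp only [gaussianDensity, Complex.norm_exp]
  congr 2
  rw [show (-(((1 / (2 * s ^ 2) : ℝ)) : ℂ) * (‖x - m‖ : ℂ) ^ 2 + 0 * ((inner ℝ 0 (x - m) : ℝ) : ℂ))
    = ((-‖x - m‖ ^ 2 / (2 * s ^ 2) : ℝ) : ℂ) by push_cast; ring, Complex.ofReal_re]

theorem stdGaussian_map_eq {d : ℕ} (m : E d) {s : ℝ} (hs : 0 < s) :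
    (stdGaussian (E d)).map (fun z => m + s • z) = densityMeasure (gaussianDensity m s) := by
  have hint := integrable_gaussianDensity m hs
  have : IsFiniteMeasure (densityMeasure (gaussianDensity m s)) :=
    isFiniteMeasure_withDensity_ofReal hint.2
  have : IsFiniteMeasure ((stdGaussian (E d)).map (fun z => m + s • z)) :=
    Measure.isFiniteMeasure_map _ _
  apply Measure.ext_of_charFun
  ext u
  have hmeas : Measurable (gaussianDensity m s) :=
    ((continuous_gaussianDensity s).comp (by fun_prop : Continuous fun x : E d => (m, x))).measurable
  have hL : charFun ((stdGaussian (E d)).map (fun z => m + s • z)) u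
      = Complex.exp ((inner ℝ m u : ℝ) * Complex.I) * Complex.exp (-(s ^ 2 * ‖u‖ ^ 2) / 2) := by
    rw [charFun_apply, integral_map (by fun_prop) (by fun_prop)]
    have h1 : ∀ z : E d, Complex.exp ((inner ℝ (m + s • z) u : ℝ) * Complex.I)
        = Complex.exp ((inner ℝ m u : ℝ) * Complex.I)
          * Complex.exp ((inner ℝ z (s • u) : ℝ) * Complex.I) := by
      intro z
      rw [← Complex.exp_add, inner_add_left, real_inner_smul_left, real_inner_smul_right]
      push_cast; ring_nf
    simp_rw [h1]
    rw [integral_const_mul, ← charFun_apply, charFun_stdGaussian, norm_smul]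
    congr 2
    simp [mul_pow, ← Complex.ofReal_pow]
  have hb : 0 < (((1 / (2 * s ^ 2) : ℝ)) : ℂ).re := by rw [Complex.ofReal_re]; positivity
  have hR : charFun (densityMeasure (gaussianDensity m s)) u
      = Complex.exp ((inner ℝ m u : ℝ) * Complex.I) * Complex.exp (-(s ^ 2 * ‖u‖ ^ 2) / 2) := by
    rw [charFun_apply, densityMeasure,
      integral_withDensity_eq_integral_toReal_smul (by fun_prop) (by simp)]
    rw [← integral_add_right_eq_self _ m]
    have h1 : ∀ x : E d, (ENNReal.ofReal (gaussianDensity m s (x + m))).toReal •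
          Complex.exp ((inner ℝ (x + m) u : ℝ) * Complex.I)
        = ((((2 * Real.pi * s ^ 2) ^ ((d : ℝ) / 2))⁻¹ : ℝ) : ℂ)
          * Complex.exp ((inner ℝ m u : ℝ) * Complex.I)
          * Complex.exp (-(((1 / (2 * s ^ 2) : ℝ)) : ℂ) * ‖x‖ ^ 2
              + Complex.I * (inner ℝ u x : ℝ)) := by
      intro x
      rw [ENNReal.toReal_ofReal (gaussianDensity_nonneg _ _ _), gaussianDensity,
        Complex.real_smul, add_sub_cancel_right, Complex.ofReal_mul, Complex.ofReal_exp,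
        mul_assoc _ (Complex.exp _) (Complex.exp _), mul_assoc _ (Complex.exp _) (Complex.exp _),
        ← Complex.exp_add, ← Complex.exp_add, inner_add_left, real_inner_comm u x]
      push_cast; ring_nf
    simp_rw [h1]
    rw [integral_const_mul, GaussianFourier.integral_cexp_neg_mul_sq_norm_add hb]
    have h2 : ((Real.pi : ℂ) / ((1 / (2 * s ^ 2) : ℝ) : ℂ)) ^
        ((Module.finrank ℝ (E d) : ℂ) / 2)
        = (((2 * Real.pi * s ^ 2) ^ ((d : ℝ) / 2) : ℝ) : ℂ) := by
      rw [← Complex.ofReal_div, Complex.ofReal_cpow (by positivity)]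
      rw [finrank_euclideanSpace_fin]
      congr 1
      · congr 1; field_simp
      · push_cast; rfl
    have h3 : (((2 * Real.pi * s ^ 2) ^ ((d : ℝ) / 2) : ℝ) : ℂ) ≠ 0 := by
      exact_mod_cast (by positivity : (2 * Real.pi * s ^ 2) ^ ((d : ℝ) / 2) ≠ 0)
    rw [h2, Complex.ofReal_inv]
    have h4 : Complex.I ^ 2 * (‖u‖ : ℂ) ^ 2 / (4 * ((1 / (2 * s ^ 2) : ℝ) : ℂ))
        = -(s ^ 2 * ‖u‖ ^ 2) / 2 := by
      have : (s : ℂ) ≠ 0 := by exact_mod_cast hs.ne'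
      rw [Complex.I_sq]; push_cast; field_simp; ring
    rw [h4]
    field_simp
  rw [hL, hR]

theorem transitionDensity_nonneg {d : ℕ} (t : ℝ) (x x₀ : E d) : 0 ≤ transitionDensity t x x₀ :=
  gaussianDensity_nonneg _ _ _

theorem measurable_transitionDensity {d : ℕ} (t : ℝ) :
    Measurable fun y : E d × E d => transitionDensity t y.1 y.2 := by
  unfold transitionDensity gaussianDensity; fun_prop

theorem measurable_transitionDensity_left {d : ℕ} (t : ℝ) (x₀ : E d) :
    Measurable fun x => transitionDensity t x x₀ := by
  unfold transitionDensity gaussianDensity; fun_prop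

theorem measurable_transitionDensity_right {d : ℕ} (t : ℝ) (x : E d) :
    Measurable fun x₀ => transitionDensity t x x₀ := by
  unfold transitionDensity gaussianDensity; fun_prop

theorem IsProbDensity.integrable {d : ℕ} {p : E d → ℝ} (hp : IsProbDensity p) : Integrable p := by
  refine ⟨hp.measurable.aestronglyMeasurable, ?_⟩
  rw [hasFiniteIntegral_iff_ofReal (Filter.Eventually.of_forall hp.nonneg), hp.lintegral_eq_one]
  simp

theorem integrable_transitionDensity_mul {d : ℕ} (t : ℝ) {p : E d → ℝ} (hp : IsProbDensity p)
    (x : E d) : Integrable fun x₀ => transitionDensity t x x₀ * p x₀ := by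
  have hKx := measurable_transitionDensity_right t x
  refine hp.integrable.bdd_mul (c := ((2 * Real.pi * t ^ 2) ^ ((d : ℝ) / 2))⁻¹)
    hKx.aestronglyMeasurable (Filter.Eventually.of_forall fun x₀ => ?_)
  rw [Real.norm_of_nonneg (transitionDensity_nonneg t x x₀)]
  exact gaussianDensity_le _ _ _

theorem ofReal_marginalDensity {d : ℕ} (t : ℝ) {p : E d → ℝ} (hp : IsProbDensity p) (x : E d) :
    ENNReal.ofReal (marginalDensity t p x)
      = ∫⁻ x₀, ENNReal.ofReal (transitionDensity t x x₀) * ENNReal.ofReal (p x₀) := by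
  rw [marginalDensity, ofReal_integral_eq_lintegral_ofReal
    (integrable_transitionDensity_mul t hp x)
    (Filter.Eventually.of_forall fun x₀ =>
      mul_nonneg (transitionDensity_nonneg t x x₀) (hp.nonneg x₀))]
  exact lintegral_congr fun x₀ => ENNReal.ofReal_mul (transitionDensity_nonneg t x x₀)

theorem noisedLaw_eq {d : ℕ} {t : ℝ} (ht : 0 < t) {p : E d → ℝ} (hp : IsProbDensity p) :
    noisedLaw t p = densityMeasure (marginalDensity t p) := by
  have hpm := hp.measurable
  have hmarg := ofReal_marginalDensity t hp
  have hK1 : Measurable fun y : E d × E d =>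
      ENNReal.ofReal (transitionDensity t y.1 y.2) := (measurable_transitionDensity t).ennreal_ofReal
  have hpe : Measurable fun x => ENNReal.ofReal (p x) := hpm.ennreal_ofReal
  have hm2 : Measurable fun x => ENNReal.ofReal (marginalDensity t p x) := by
    simp_rw [hmarg]
    exact (hK1.mul (hpe.comp measurable_snd)).lintegral_prod_right'
  have : IsFiniteMeasure (densityMeasure p) := isFiniteMeasure_withDensity_ofReal hp.integrable.2
  have hstep : ∀ f : E d → ℝ≥0∞, Measurable f →
      ∫⁻ x, f x ∂(noisedLaw t p) = ∫⁻ x, f x ∂(densityMeasure (marginalDensity t p)) := by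
    intro f hf
    have hinner : ∀ x₀ : E d, ∫⁻ z, f ((1 - t) • x₀ + t • z) ∂(stdGaussian (E d))
        = ∫⁻ x, ENNReal.ofReal (transitionDensity t x x₀) * f x := fun x₀ => by
      have h1 := lintegral_map (μ := stdGaussian (E d)) (g := fun z => (1 - t) • x₀ + t • z) hf
        (by fun_prop)
      rw [← h1, stdGaussian_map_eq _ ht]
      exact lintegral_withDensity_eq_lintegral_mul _
        (measurable_transitionDensity_left t x₀).ennreal_ofReal hf
    have hF : Measurable fun x₀ : E d => ∫⁻ x, ENNReal.ofReal (transitionDensity t x x₀) * f x :=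
      (hK1.mul (hf.comp measurable_fst)).lintegral_prod_left'
    have hleft : ∫⁻ x, f x ∂(noisedLaw t p) = ∫⁻ x₀, ENNReal.ofReal (p x₀) *
        ∫⁻ x, ENNReal.ofReal (transitionDensity t x x₀) * f x := by
      rw [noisedLaw, lintegral_map hf (by fun_prop), lintegral_prod _ (by fun_prop)]
      simp only [hinner]
      exact lintegral_withDensity_eq_lintegral_mul _ hpe hF
    have hright : ∫⁻ x, f x ∂(densityMeasure (marginalDensity t p)) =
        ∫⁻ x, (∫⁻ x₀, ENNReal.ofReal (transitionDensity t x x₀) * ENNReal.ofReal (p x₀)) * f x := by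
      simp only [← hmarg]
      exact lintegral_withDensity_eq_lintegral_mul _ hm2 hf
    have e1 : ∀ x₀ : E d, ENNReal.ofReal (p x₀) *
          ∫⁻ x, ENNReal.ofReal (transitionDensity t x x₀) * f x
        = ∫⁻ x, ENNReal.ofReal (transitionDensity t x x₀) * ENNReal.ofReal (p x₀) * f x := by
      intro x₀
      rw [← lintegral_const_mul' _ _ ENNReal.ofReal_ne_top]
      exact lintegral_congr fun x => by ring
    have e2 : ∀ x : E d,
        (∫⁻ x₀, ENNReal.ofReal (transitionDensity t x x₀) * ENNReal.ofReal (p x₀)) * f x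
        = ∫⁻ x₀, ENNReal.ofReal (transitionDensity t x x₀) * ENNReal.ofReal (p x₀) * f x := by
      intro x
      exact (lintegral_mul_const _
        ((measurable_transitionDensity_right t x).ennreal_ofReal.mul hpe)).symm
    rw [hleft, hright]
    simp only [e1, e2]
    exact lintegral_lintegral_swap (((hK1.comp measurable_swap).mul
      (hpe.comp measurable_fst)).mul (hf.comp measurable_snd)).aemeasurable
  ext A hA
  have := hstep (A.indicator 1) (measurable_one.indicator hA)
  rwa [lintegral_indicator_one hA, lintegral_indicator_one hA] at this

end Noising

end

noncomputable section

namespace Noising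

variable {d : ℕ} {t : ℝ} {p q : E d → ℝ}

/-! ### Cauchy-Schwarz and Jensen inequalities for lower Lebesgue integrals -/

/-! Write p, q for the two initial densities. The score of a noised density is a conditional mean
given X_t, in three ways: Tweedie's formula (`score_marginalDensity`) expresses it through the
noise; expanding that gives the posterior mean of X_0 plus the term -x/t², which does not depend on
the density (`score_marginalDensity_eq_condMean_snd`); integration by parts gives 1/(1-t) times the
posterior mean of the initial score (`score_marginalDensity_eq_condMean_score`).

The first term of the minimum needs only the triangle inequality, conditional Jensen and fourth
moments: the noise form serves for small t, the X_0 form for t near 1, where -x/t² cancels in the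
difference. The q-mean has to be integrated against p_t; `lintegral_marginalDensity_le` does this at
the price of χ_2 and a doubled exponent.

For the second term, the posterior of q is rewritten as the posterior of p with weight w =
(q/p)(X_0) · (p_t/q_t)(X_t), so the score difference is 1/(1-t) times the p-conditional mean of s_p
- w s_q = (s_p - s_q) + (1-w) s_q. Jensen turns the first summand into FI(p|q). Cauchy-Schwarz
bounds the second by the fourth moments of s_q and of 1-w; the latter is controlled by χ_16 through
the data processing inequality (`chiDiv_marginalDensity_le`, `lintegral_jointLaw_weight_le`). -/

theorem lintegral_mul_le_sqrt_mul_sqrt {α : Type*} [MeasurableSpace α] (μ : Measure α)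
    {f g : α → ℝ≥0∞} (hf : AEMeasurable f μ) (hg : AEMeasurable g μ) :
    ∫⁻ a, f a * g a ∂μ ≤ (∫⁻ a, f a ^ 2 ∂μ) ^ (1 / 2 : ℝ) * (∫⁻ a, g a ^ 2 ∂μ) ^ (1 / 2 : ℝ) := by
  have := ENNReal.lintegral_mul_le_Lp_mul_Lq μ Real.HolderConjugate.two_two hf hg
  simpa only [Pi.mul_apply, ENNReal.rpow_two] using this

theorem sq_lintegral_le_lintegral_sq {α : Type*} [MeasurableSpace α] (μ : Measure α)
    [IsProbabilityMeasure μ] {f : α → ℝ≥0∞} (hf : AEMeasurable f μ) :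
    (∫⁻ a, f a ∂μ) ^ 2 ≤ ∫⁻ a, f a ^ 2 ∂μ := by
  have := lintegral_mul_le_sqrt_mul_sqrt μ hf (aemeasurable_const (b := (1 : ℝ≥0∞)))
  simp only [mul_one, one_pow, lintegral_const, measure_univ, ENNReal.one_rpow] at this
  calc (∫⁻ a, f a ∂μ) ^ 2 ≤ ((∫⁻ a, f a ^ 2 ∂μ) ^ (1 / 2 : ℝ)) ^ 2 := by gcongr
    _ = _ := by rw [← ENNReal.rpow_two, ← ENNReal.rpow_mul]; norm_num

/-- Iterating Cauchy-Schwarz against 1 reaches powers of two only, which suffices: the exponents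
needed are 2, 4 and 16. -/
theorem lintegral_pow_le_lintegral_pow {α : Type*} [MeasurableSpace α] (μ : Measure α)
    [IsProbabilityMeasure μ] (k : ℕ) {f : α → ℝ≥0∞} (hf : AEMeasurable f μ) :
    (∫⁻ a, f a ∂μ) ^ 2 ^ k ≤ ∫⁻ a, f a ^ 2 ^ k ∂μ := by
  induction k with
  | zero => simp
  | succ k ih =>
    calc (∫⁻ a, f a ∂μ) ^ 2 ^ (k + 1) = ((∫⁻ a, f a ∂μ) ^ 2 ^ k) ^ 2 := by rw [pow_succ, pow_mul]
      _ ≤ (∫⁻ a, f a ^ 2 ^ k ∂μ) ^ 2 := by gcongr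
      _ ≤ ∫⁻ a, (f a ^ 2 ^ k) ^ 2 ∂μ := sq_lintegral_le_lintegral_sq μ (hf.pow_const _)
      _ = _ := by simp_rw [← pow_mul, ← pow_succ]

/-! ### The marginal density and the joint law -/

theorem gaussianDensity_pos (m : E d) {s : ℝ} (hs : 0 < s) (x : E d) :
    0 < gaussianDensity m s x := by
  unfold gaussianDensity; positivity

theorem transitionDensity_pos (ht : 0 < t) (x x₀ : E d) : 0 < transitionDensity t x x₀ :=
  gaussianDensity_pos _ ht _

/-- The Gaussian kernel never vanishes, so a zero would force p = 0 almost everywhere, against total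
mass one. -/
theorem marginalDensity_pos (ht : 0 < t) (hp : IsProbDensity p) (x : E d) :
    0 < marginalDensity t p x := by
  have hpos : ∀ x₀, 0 ≤ transitionDensity t x x₀ * p x₀ := fun x₀ =>
    mul_nonneg (transitionDensity_nonneg t x x₀) (hp.nonneg x₀)
  refine lt_of_le_of_ne (integral_nonneg hpos) fun h => ?_
  have h0 := (integral_eq_zero_iff_of_nonneg hpos (integrable_transitionDensity_mul t hp x)).1 h.symm
  have h1 : ∀ᵐ x₀ : E d, ENNReal.ofReal (p x₀) = 0 := by
    filter_upwards [h0] with x₀ hx₀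
    have := (mul_eq_zero.1 hx₀).resolve_left (transitionDensity_pos ht x x₀).ne'
    simp [this]
  have h2 := hp.lintegral_eq_one
  rw [lintegral_congr_ae h1] at h2
  simp at h2

theorem measurable_marginalDensity (hp : IsProbDensity p) : Measurable (marginalDensity t p) := by
  have h : StronglyMeasurable fun y : E d × E d => transitionDensity t y.1 y.2 * p y.2 :=
    ((measurable_transitionDensity t).mul (hp.measurable.comp measurable_snd)).stronglyMeasurable
  exact h.integral_prod_right'.measurable

theorem lintegral_densityMeasure (hp : Measurable p) {g : E d → ℝ≥0∞} (hg : Measurable g) :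
    ∫⁻ x, g x ∂(densityMeasure p) = ∫⁻ x, ENNReal.ofReal (p x) * g x :=
  lintegral_withDensity_eq_lintegral_mul _ hp.ennreal_ofReal hg

theorem IsProbDensity.isProbabilityMeasure (hp : IsProbDensity p) :
    IsProbabilityMeasure (densityMeasure p) :=
  ⟨by rw [densityMeasure, withDensity_apply _ MeasurableSet.univ, Measure.restrict_univ,
    hp.lintegral_eq_one]⟩

/-- The joint law of `(X_t, X_0)` when `X_0` has density `p`. -/
def jointLaw (t : ℝ) (p : E d → ℝ) : Measure (E d × E d) :=
  (volume.prod volume).withDensity fun y =>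
    ENNReal.ofReal (transitionDensity t y.1 y.2) * ENNReal.ofReal (p y.2)

theorem measurable_jointDensity (hp : IsProbDensity p) : Measurable fun y : E d × E d =>
    ENNReal.ofReal (transitionDensity t y.1 y.2) * ENNReal.ofReal (p y.2) :=
  (measurable_transitionDensity t).ennreal_ofReal.mul
    (hp.measurable.ennreal_ofReal.comp measurable_snd)

theorem lintegral_jointLaw (hp : IsProbDensity p) {g : E d × E d → ℝ≥0∞} (hg : Measurable g) :
    ∫⁻ y, g y ∂(jointLaw t p) = ∫⁻ x, ∫⁻ x₀,
      ENNReal.ofReal (transitionDensity t x x₀) * ENNReal.ofReal (p x₀) * g (x, x₀) := by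
  rw [jointLaw, lintegral_withDensity_eq_lintegral_mul _ (measurable_jointDensity hp) hg,
    lintegral_prod _ ((measurable_jointDensity hp).mul hg).aemeasurable]
  rfl

theorem lintegral_jointLaw_symm (hp : IsProbDensity p) {g : E d × E d → ℝ≥0∞}
    (hg : Measurable g) :
    ∫⁻ y, g y ∂(jointLaw t p) = ∫⁻ x₀, ENNReal.ofReal (p x₀) *
      ∫⁻ x, ENNReal.ofReal (transitionDensity t x x₀) * g (x, x₀) := by
  rw [jointLaw, lintegral_withDensity_eq_lintegral_mul _ (measurable_jointDensity hp) hg,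
    lintegral_prod_symm _ ((measurable_jointDensity hp).mul hg).aemeasurable]
  refine lintegral_congr fun x₀ => ?_
  rw [← lintegral_const_mul' _ _ ENNReal.ofReal_ne_top]
  refine lintegral_congr fun x => ?_
  simp only [Pi.mul_apply]
  ring

theorem lintegral_transitionDensity_mul (ht : 0 < t) (x₀ : E d) {f : E d → ℝ≥0∞}
    (hf : Measurable f) : ∫⁻ x, ENNReal.ofReal (transitionDensity t x x₀) * f x =
      ∫⁻ z, f ((1 - t) • x₀ + t • z) ∂(stdGaussian (E d)) := by
  rw [← lintegral_map (μ := stdGaussian (E d)) (g := fun z => (1 - t) • x₀ + t • z) hf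
    (by fun_prop), stdGaussian_map_eq _ ht,
    lintegral_densityMeasure (p := gaussianDensity ((1 - t) • x₀) t)
      (measurable_transitionDensity_left t x₀) hf]
  rfl

theorem lintegral_transitionDensity (ht : 0 < t) (x₀ : E d) :
    ∫⁻ x, ENNReal.ofReal (transitionDensity t x x₀) = 1 := by
  simpa using lintegral_transitionDensity_mul ht x₀ (measurable_const (a := (1 : ℝ≥0∞)))

theorem lintegral_jointLaw_snd (ht : 0 < t) (hp : IsProbDensity p) {g : E d → ℝ≥0∞}
    (hg : Measurable g) : ∫⁻ y, g y.2 ∂(jointLaw t p) = ∫⁻ x, g x ∂(densityMeasure p) := by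
  rw [lintegral_jointLaw_symm hp (g := fun y => g y.2) (hg.comp measurable_snd),
     lintegral_densityMeasure hp.measurable hg]
  refine lintegral_congr fun x₀ => ?_
  dsimp only
  rw [lintegral_mul_const _ (measurable_transitionDensity_left t x₀).ennreal_ofReal,
    lintegral_transitionDensity ht, one_mul]

theorem lintegral_jointLaw_fst (hp : IsProbDensity p) {g : E d → ℝ≥0∞} (hg : Measurable g) :
    ∫⁻ y, g y.1 ∂(jointLaw t p) = ∫⁻ x, g x ∂(densityMeasure (marginalDensity t p)) := by
  rw [lintegral_jointLaw hp (g := fun y => g y.1) (hg.comp measurable_fst),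
    lintegral_densityMeasure (measurable_marginalDensity hp) hg]
  refine lintegral_congr fun x => ?_
  rw [ofReal_marginalDensity t hp]
  have hm : Measurable fun x₀ =>
      ENNReal.ofReal (transitionDensity t x x₀) * ENNReal.ofReal (p x₀) :=
    (measurable_transitionDensity_right t x).ennreal_ofReal.mul hp.measurable.ennreal_ofReal
  exact lintegral_mul_const (g x) hm

theorem isProbabilityMeasure_jointLaw (ht : 0 < t) (hp : IsProbDensity p) :
    IsProbabilityMeasure (jointLaw t p) := by
  have := hp.isProbabilityMeasure
  refine ⟨?_⟩
  rw [← lintegral_one, lintegral_jointLaw_snd ht hp (g := fun _ => 1) measurable_const]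
  simp

theorem isProbDensity_marginalDensity (ht : 0 < t) (hp : IsProbDensity p) :
    IsProbDensity (marginalDensity t p) where
  measurable := measurable_marginalDensity hp
  nonneg x := (marginalDensity_pos ht hp x).le
  lintegral_eq_one := by
    have h1 := lintegral_jointLaw_fst (t := t) hp (g := fun _ => 1) measurable_const
    rw [lintegral_densityMeasure (measurable_marginalDensity hp) measurable_const] at h1
    have := isProbabilityMeasure_jointLaw ht hp
    simpa using h1.symm

/-! ### Conditional means given `X_t` -/

/-- The conditional mean of `f(X_t, X_0)` given `X_t = x`, when `X_0` has density `p`. -/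
def condMean {F : Type*} [NormedAddCommGroup F] [NormedSpace ℝ F] (t : ℝ) (p : E d → ℝ)
    (f : E d → E d → F) (x : E d) : F :=
  (marginalDensity t p x)⁻¹ • ∫ x₀, (transitionDensity t x x₀ * p x₀) • f x x₀

theorem lintegral_posteriorDensity (ht : 0 < t) (hp : IsProbDensity p) (x : E d) :
    ∫⁻ x₀, ENNReal.ofReal (posteriorDensity t p x₀ x) = 1 := by
  have hm := marginalDensity_pos ht hp x
  rw [← ofReal_integral_eq_lintegral_ofReal]
  · simp only [posteriorDensity]
    rw [integral_div, ← marginalDensity, div_self hm.ne', ENNReal.ofReal_one]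
  · exact (integrable_transitionDensity_mul t hp x).div_const _
  · exact Filter.Eventually.of_forall fun x₀ =>
      div_nonneg (mul_nonneg (transitionDensity_nonneg t x x₀) (hp.nonneg x₀)) hm.le

theorem measurable_posteriorDensity (hp : IsProbDensity p) (x : E d) :
    Measurable fun x₀ => posteriorDensity t p x₀ x :=
  ((measurable_transitionDensity_right t x).mul hp.measurable).div_const _

theorem ofReal_marginalDensity_mul_posteriorDensity (ht : 0 < t) (hp : IsProbDensity p)
    (x x₀ : E d) :
    ENNReal.ofReal (marginalDensity t p x) * ENNReal.ofReal (posteriorDensity t p x₀ x)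
      = ENNReal.ofReal (transitionDensity t x x₀) * ENNReal.ofReal (p x₀) := by
  have hm := marginalDensity_pos ht hp x
  rw [← ENNReal.ofReal_mul hm.le, ← ENNReal.ofReal_mul (transitionDensity_nonneg t x x₀),
    posteriorDensity, mul_div_cancel₀ _ hm.ne']

theorem measurable_condMean {F : Type*} [NormedAddCommGroup F] [NormedSpace ℝ F]
    [MeasurableSpace F] [BorelSpace F] [SecondCountableTopology F] (hp : IsProbDensity p)
    {f : E d → E d → F} (hf : Measurable (Function.uncurry f)) : Measurable (condMean t p f) := by
  have h : StronglyMeasurable fun y : E d × E d =>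
      (transitionDensity t y.1 y.2 * p y.2) • f y.1 y.2 :=
    (((measurable_transitionDensity t).mul (hp.measurable.comp measurable_snd)).smul
      hf).stronglyMeasurable
  exact (measurable_marginalDensity hp).inv.smul h.integral_prod_right'.measurable

/-- Jensen's inequality for the conditional mean. -/
theorem lintegral_enorm_condMean_pow_le {F : Type*} [NormedAddCommGroup F] [NormedSpace ℝ F]
    [MeasurableSpace F] [BorelSpace F] [SecondCountableTopology F]
    (ht : 0 < t) (hp : IsProbDensity p) (k : ℕ) {f : E d → E d → F}
    (hf : Measurable (Function.uncurry f)) :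
    ∫⁻ x, ‖condMean t p f x‖ₑ ^ 2 ^ k ∂(densityMeasure (marginalDensity t p))
      ≤ ∫⁻ y, ‖f y.1 y.2‖ₑ ^ 2 ^ k ∂(jointLaw t p) := by
  have hc := measurable_condMean (t := t) hp hf
  rw [lintegral_densityMeasure (measurable_marginalDensity hp) (hc.enorm.pow_const _),
    lintegral_jointLaw hp (g := fun y => ‖f y.1 y.2‖ₑ ^ 2 ^ k) (hf.enorm.pow_const _)]
  refine lintegral_mono fun x => ?_
  have hm := marginalDensity_pos ht hp x
  have hpm := measurable_posteriorDensity (t := t) hp x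
  have hfx : Measurable (f x) := hf.comp measurable_prodMk_left
  -- Jensen is applied for each fixed x under the posterior; multiplying by the marginal density
  -- then rebuilds the joint density.
  let π : Measure (E d) := densityMeasure fun x₀ => posteriorDensity t p x₀ x
  have hπ : IsProbabilityMeasure π :=
    ⟨by simp only [π]; rw [densityMeasure, withDensity_apply _ MeasurableSet.univ,
      Measure.restrict_univ, lintegral_posteriorDensity ht hp]⟩
  have h1 : ‖condMean t p f x‖ₑ ≤ ∫⁻ x₀, ‖f x x₀‖ₑ ∂π := by
    rw [lintegral_densityMeasure hpm hfx.enorm]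
    have : condMean t p f x = ∫ x₀, posteriorDensity t p x₀ x • f x x₀ := by
      rw [condMean, ← integral_smul]
      refine integral_congr_ae (Filter.Eventually.of_forall fun x₀ => ?_)
      simp only [posteriorDensity, smul_smul]
      congr 1
      ring
    rw [this]
    refine (enorm_integral_le_lintegral_enorm _).trans (le_of_eq (lintegral_congr fun x₀ => ?_))
    rw [enorm_smul, Real.enorm_of_nonneg]
    exact div_nonneg (mul_nonneg (transitionDensity_nonneg t x x₀) (hp.nonneg x₀)) hm.le
  calc ENNReal.ofReal (marginalDensity t p x) * ‖condMean t p f x‖ₑ ^ 2 ^ k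
      ≤ ENNReal.ofReal (marginalDensity t p x) * ∫⁻ x₀, ‖f x x₀‖ₑ ^ 2 ^ k ∂π := by
        gcongr
        exact (pow_le_pow_left' h1 _).trans
          (lintegral_pow_le_lintegral_pow π k hfx.enorm.aemeasurable)
    _ = _ := by
        rw [lintegral_densityMeasure hpm (hfx.enorm.pow_const _),
          ← lintegral_const_mul' _ _ ENNReal.ofReal_ne_top]
        refine lintegral_congr fun x₀ => ?_
        rw [← mul_assoc, ofReal_marginalDensity_mul_posteriorDensity ht hp]

/-! ### Divergences -/

theorem ae_eq_zero_of_chiDiv_ne_top {α : ℝ} (hp : IsProbDensity p) (hq : IsProbDensity q)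
    (h : chiDiv α p q ≠ ∞) : ∀ᵐ x : E d, q x = 0 → p x = 0 := by
  have hpm := hp.measurable
  have hqm := hq.measurable
  unfold chiDiv at h
  have := ae_lt_top' (Measurable.aemeasurable ?_) h
  · filter_upwards [this] with x hx hqx
    by_contra hpx
    simp [hqx, hpx] at hx
  · refine Measurable.ite (hqm (measurableSet_singleton 0)) ?_ (by fun_prop)
    exact Measurable.ite (hpm (measurableSet_singleton 0)) measurable_const measurable_const

/-- Under absolute continuity the special values of the integrand are harmless: where q = 0 the
quotient is 0 by convention, but the measure has no mass there. -/
theorem chiDiv_eq_lintegral (n : ℕ) (hp : IsProbDensity p) (hq : IsProbDensity q)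
    (h : ∀ᵐ x : E d, q x = 0 → p x = 0) :
    chiDiv n p q = ∫⁻ x, ‖1 - p x / q x‖ₑ ^ n ∂(densityMeasure q) := by
  have hpm := hp.measurable
  have hqm := hq.measurable
  rw [lintegral_densityMeasure hqm (by fun_prop), chiDiv]
  refine lintegral_congr_ae ?_
  filter_upwards [h] with x hx
  by_cases hqx : q x = 0
  · simp [hqx, hx hqx]
  · rw [if_neg hqx, ENNReal.ofReal_mul (by positivity), Real.rpow_natCast,
      ENNReal.ofReal_pow (abs_nonneg _), mul_comm, ← Real.enorm_eq_ofReal_abs]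

theorem chiDiv_eq_lintegral_of_pos (n : ℕ) (hp : IsProbDensity p) (hq : IsProbDensity q)
    (h : ∀ x, 0 < q x) :
    chiDiv n p q = ∫⁻ x, ‖1 - p x / q x‖ₑ ^ n ∂(densityMeasure q) :=
  chiDiv_eq_lintegral n hp hq (Filter.Eventually.of_forall fun x hx => absurd hx (h x).ne')

/-- Data processing inequality. -/
theorem chiDiv_marginalDensity_le (ht : 0 < t) (k : ℕ) (hp : IsProbDensity p)
    (hq : IsProbDensity q) :
    chiDiv ((2 ^ k : ℕ) : ℝ) (marginalDensity t p) (marginalDensity t q)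
      ≤ chiDiv ((2 ^ k : ℕ) : ℝ) p q := by
  by_cases htop : chiDiv ((2 ^ k : ℕ) : ℝ) p q = ∞
  · rw [htop]; exact le_top
  have hac := ae_eq_zero_of_chiDiv_ne_top hp hq htop
  have hpm := hp.measurable
  have hqm := hq.measurable
  have hmq := marginalDensity_pos ht hq
  rw [chiDiv_eq_lintegral _ hp hq hac, chiDiv_eq_lintegral_of_pos _
    (isProbDensity_marginalDensity ht hp) (isProbDensity_marginalDensity ht hq) hmq]
  -- Under q, the function 1 - p_t/q_t of X_t is the conditional mean of 1 - p/q at X_0, so data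
  -- processing is conditional Jensen.
  have key := lintegral_enorm_condMean_pow_le ht hq k
    (f := fun _ x₀ => 1 - p x₀ / q x₀) (by unfold Function.uncurry; fun_prop)
  rw [lintegral_jointLaw_snd ht hq (g := fun x₀ => ‖1 - p x₀ / q x₀‖ₑ ^ 2 ^ k)
    (by fun_prop)] at key
  refine le_trans (le_of_eq (lintegral_congr fun x => ?_)) key
  congr 2
  have h1 : ∫ x₀, (transitionDensity t x x₀ * q x₀) • (1 - p x₀ / q x₀)
      = marginalDensity t q x - marginalDensity t p x := by
    rw [marginalDensity, marginalDensity, ← integral_sub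
      (integrable_transitionDensity_mul t hq x) (integrable_transitionDensity_mul t hp x)]
    refine integral_congr_ae ?_
    filter_upwards [hac] with x₀ hx₀
    by_cases h0 : q x₀ = 0
    · simp [h0, hx₀ h0]
    · simp only [smul_eq_mul]; field_simp
  rw [condMean, h1, smul_eq_mul]
  have := (hmq x).ne'
  field_simp

theorem enorm_pow_le_two_mul (a : ℝ) (n : ℕ) :
    ‖a‖ₑ ^ (n + 1) ≤ 2 ^ n * (1 + ‖1 - a‖ₑ ^ (n + 1)) := by
  have h : ‖a‖ₑ ≤ 1 + ‖1 - a‖ₑ := by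
    calc ‖a‖ₑ = ‖(1 : ℝ) - (1 - a)‖ₑ := by rw [sub_sub_cancel]
      _ ≤ ‖(1 : ℝ)‖ₑ + ‖1 - a‖ₑ := enorm_sub_le
      _ = _ := by simp
  calc ‖a‖ₑ ^ (n + 1) ≤ (1 + ‖1 - a‖ₑ) ^ (n + 1) := by gcongr
    _ ≤ 2 ^ n * (1 ^ (n + 1) + ‖1 - a‖ₑ ^ (n + 1)) := by
        have := ENNReal.rpow_add_le_mul_rpow_add_rpow 1 ‖1 - a‖ₑ (p := (n + 1 : ℕ))
          (by exact_mod_cast n.succ_pos)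
        rw [show ((n + 1 : ℕ) : ℝ) - 1 = (n : ℕ) by push_cast; ring] at this
        simpa only [ENNReal.rpow_natCast] using this
    _ = _ := by rw [one_pow]

theorem lintegral_enorm_div_pow_le (n : ℕ) (hp : IsProbDensity p) (hq : IsProbDensity q)
    (h : ∀ᵐ x : E d, q x = 0 → p x = 0) :
    ∫⁻ x, ‖p x / q x‖ₑ ^ (n + 1) ∂(densityMeasure q)
      ≤ 2 ^ n * (1 + chiDiv ((n + 1 : ℕ) : ℝ) p q) := by
  have := hq.isProbabilityMeasure
  have hpm := hp.measurable
  have hqm := hq.measurable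
  rw [chiDiv_eq_lintegral _ hp hq h]
  refine (lintegral_mono fun x => enorm_pow_le_two_mul _ n).trans (le_of_eq ?_)
  rw [lintegral_const_mul _ (by fun_prop), lintegral_add_left measurable_const]
  simp

/-- Change of measure between the two marginals. -/
theorem lintegral_marginalDensity_le (ht : 0 < t) (hp : IsProbDensity p) (hq : IsProbDensity q)
    {g : E d → ℝ≥0∞} (hg : Measurable g) :
    ∫⁻ x, g x ∂(densityMeasure (marginalDensity t p))
      ≤ (∫⁻ x, g x ^ 2 ∂(densityMeasure (marginalDensity t q))) ^ (1 / 2 : ℝ)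
        * (2 * (1 + chiDiv 2 p q)) ^ (1 / 2 : ℝ) := by
  have hP := isProbDensity_marginalDensity ht hp
  have hQ := isProbDensity_marginalDensity ht hq
  have hPm := hP.measurable
  have hQm := hQ.measurable
  have hpos := marginalDensity_pos ht hq
  -- The likelihood ratio p_t/q_t is inserted and split off by Cauchy-Schwarz; its second moment
  -- under q_t is at most 2(1 + χ_2), by data processing.
  have h1 : ∫⁻ x, g x ∂(densityMeasure (marginalDensity t p)) = ∫⁻ x,
      g x * ‖marginalDensity t p x / marginalDensity t q x‖ₑ
        ∂(densityMeasure (marginalDensity t q)) := by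
    rw [lintegral_densityMeasure hPm hg, lintegral_densityMeasure hQm (by fun_prop)]
    refine lintegral_congr fun x => ?_
    rw [Real.enorm_of_nonneg (div_nonneg (hP.nonneg x) (hQ.nonneg x)), mul_left_comm,
      ← ENNReal.ofReal_mul (hQ.nonneg x), mul_div_cancel₀ _ (hpos x).ne', mul_comm]
  rw [h1]
  refine (lintegral_mul_le_sqrt_mul_sqrt _ hg.aemeasurable (by fun_prop)).trans ?_
  gcongr
  refine (lintegral_enorm_div_pow_le 1 hP hQ
    (Filter.Eventually.of_forall fun x hx => absurd hx (hpos x).ne')).trans ?_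
  rw [pow_one]
  gcongr
  simpa using chiDiv_marginalDensity_le ht 1 hp hq

/-! ### Scores of the marginals -/

theorem measurable_score (p : E d → ℝ) : Measurable (score p) :=
  (InnerProductSpace.toDual ℝ (E d)).symm.continuous.measurable.comp (measurable_fderiv ℝ _)

/-- Zeros of p cause no trouble: each is a minimum of the nonnegative function p, so the gradient
vanishes there too. -/
theorem mul_inner_score (hp : IsProbDensity p) (hp1 : ContDiff ℝ 1 p) (x v : E d) :
    p x * inner ℝ (score p x) v = fderiv ℝ p x v := by
  have hd : DifferentiableAt ℝ p x := (hp1.differentiable one_ne_zero) x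
  by_cases h0 : p x = 0
  · have hmin : IsLocalMin p x := Filter.Eventually.of_forall fun y => h0 ▸ hp.nonneg y
    simp [h0, hmin.fderiv_eq_zero]
  · rw [score, inner_gradient_left, fderiv.log hd h0]
    simp [h0]

theorem hasFDerivAt_gaussianDensity (m : E d) {s : ℝ} (hs : 0 < s) (x : E d) :
    HasFDerivAt (gaussianDensity m s)
      (gaussianDensity m s x • innerSL ℝ (-(s ^ 2)⁻¹ • (x - m))) x := by
  have h1 : HasFDerivAt (fun y : E d => ‖y - m‖ ^ 2) (2 • innerSL ℝ (x - m)) x := by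
    have := ((hasFDerivAt_id x).sub_const m).norm_sq
    simpa using this
  have h2 := (((h1.neg).mul_const ((2 * s ^ 2)⁻¹)).exp).const_mul
    (((2 * Real.pi * s ^ 2) ^ ((d : ℝ) / 2))⁻¹)
  have h3 : gaussianDensity m s = fun y => ((2 * Real.pi * s ^ 2) ^ ((d : ℝ) / 2))⁻¹ *
      Real.exp (-‖y - m‖ ^ 2 * (2 * s ^ 2)⁻¹) := by
    ext y; rw [gaussianDensity, div_eq_mul_inv (-‖y - m‖ ^ 2)]
  rw [h3]
  refine h2.congr_fderiv ?_
  ext v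
  simp
  field_simp

/-- With v = ‖x - m‖/s this is v ≤ exp(v²/2), a consequence of v ≤ 1 + v²/2. It gives bounds on the
kernel's gradient that are uniform in space. -/
theorem gaussianDensity_mul_norm_le (m : E d) {s : ℝ} (hs : 0 < s) (x : E d) :
    gaussianDensity m s x * ‖x - m‖ ≤ ((2 * Real.pi * s ^ 2) ^ ((d : ℝ) / 2))⁻¹ * s := by
  rw [gaussianDensity, mul_assoc]
  gcongr
  set v := ‖x - m‖ / s with hv
  have hv' : ‖x - m‖ = v * s := by rw [hv]; field_simp
  have h1 : v ≤ Real.exp (v ^ 2 / 2) := by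
    have := Real.add_one_le_exp (v ^ 2 / 2)
    nlinarith [sq_nonneg (v - 1)]
  have h2 : -‖x - m‖ ^ 2 / (2 * s ^ 2) = -(v ^ 2 / 2) := by rw [hv']; field_simp
  rw [h2, hv', ← mul_assoc, Real.exp_neg]
  refine mul_le_of_le_one_left hs.le ?_
  rw [inv_mul_le_iff₀ (Real.exp_pos _)]
  simpa using h1

theorem transitionDensity_comm (t : ℝ) (x x₀ : E d) :
    transitionDensity t x x₀ = gaussianDensity x t ((1 - t) • x₀) := by
  rw [transitionDensity, gaussianDensity, gaussianDensity, norm_sub_rev]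

theorem hasFDerivAt_transitionDensity_right (ht : 0 < t) (x x₀ : E d) :
    HasFDerivAt (fun y => transitionDensity t x y) ((1 - t) • (transitionDensity t x x₀ •
      innerSL ℝ ((t ^ 2)⁻¹ • (x - (1 - t) • x₀)))) x₀ := by
  have h := (hasFDerivAt_gaussianDensity x ht ((1 - t) • x₀)).comp x₀
    ((hasFDerivAt_id x₀).const_smul (1 - t))
  have h3 : (fun y => transitionDensity t x y) = gaussianDensity x t ∘ fun y => (1 - t) • y := by
    ext y; exact transitionDensity_comm t x y
  rw [h3]
  refine h.congr_fderiv ?_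
  ext v
  simp only [transitionDensity_comm, ContinuousLinearMap.comp_apply, smul_apply,
    innerSL_apply_apply, ContinuousLinearMap.id_apply, inner_smul_left, inner_smul_right,
    inner_sub_left, smul_eq_mul, map_neg, conj_trivial]
  ring

theorem transitionDensity_mul_norm_le (ht : 0 < t) (x x₀ : E d) :
    transitionDensity t x x₀ * ‖x - (1 - t) • x₀‖
      ≤ ((2 * Real.pi * t ^ 2) ^ ((d : ℝ) / 2))⁻¹ * t :=
  gaussianDensity_mul_norm_le _ ht _

theorem integrable_transitionDensity_mul_smul_sub (ht : 0 < t) (hp : IsProbDensity p) (x : E d) :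
    Integrable fun x₀ => (transitionDensity t x x₀ * p x₀) • (x - (1 - t) • x₀) := by
  have hpm := hp.measurable
  have hK := measurable_transitionDensity_right t x
  refine (hp.integrable.const_mul (((2 * Real.pi * t ^ 2) ^ ((d : ℝ) / 2))⁻¹ * t)).mono'
    (Measurable.aestronglyMeasurable (by fun_prop)) (Filter.Eventually.of_forall fun x₀ => ?_)
  rw [norm_smul, norm_mul, Real.norm_of_nonneg (transitionDensity_nonneg t x x₀),
    Real.norm_of_nonneg (hp.nonneg x₀), mul_right_comm]
  exact mul_le_mul_of_nonneg_right (transitionDensity_mul_norm_le ht x x₀) (hp.nonneg x₀)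

/-- Tweedie's formula. -/
theorem score_marginalDensity (ht : 0 < t) (hp : IsProbDensity p) (x : E d) :
    score (marginalDensity t p) x
      = -(t ^ 2)⁻¹ • condMean t p (fun x x₀ => x - (1 - t) • x₀) x := by
  have hpm := hp.measurable
  have hK : ∀ y : E d, Measurable (transitionDensity t y) := measurable_transitionDensity_right t
  have hm := marginalDensity_pos ht hp x
  have hint := integrable_transitionDensity_mul_smul_sub ht hp x
  let F' : E d → E d → E d →L[ℝ] ℝ := fun y x₀ =>
    p x₀ • transitionDensity t y x₀ • innerSL ℝ (-(t ^ 2)⁻¹ • (y - (1 - t) • x₀))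
  have hF'm : Measurable (F' x) := by
    refine hpm.smul ((hK x).smul ?_)
    exact (innerSL ℝ (E := E d)).continuous.measurable.comp (by fun_prop)
  -- The bound does not depend on y, so a multiple of p dominates the derivatives everywhere and no
  -- neighbourhood of x has to be chosen.
  have hbound : ∀ x₀ y : E d, ‖F' y x₀‖ ≤
      (t ^ 2)⁻¹ * (((2 * Real.pi * t ^ 2) ^ ((d : ℝ) / 2))⁻¹ * t) * p x₀ := by
    intro x₀ y
    simp only [F']
    rw [norm_smul, norm_smul, innerSL_apply_norm, norm_smul, norm_neg,
      Real.norm_of_nonneg (hp.nonneg x₀), Real.norm_of_nonneg (transitionDensity_nonneg t y x₀),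
      Real.norm_of_nonneg (by positivity : (0 : ℝ) ≤ (t ^ 2)⁻¹), mul_comm (p x₀),
      mul_left_comm (transitionDensity t y x₀)]
    exact mul_le_mul_of_nonneg_right (mul_le_mul_of_nonneg_left
      (transitionDensity_mul_norm_le ht y x₀) (by positivity)) (hp.nonneg x₀)
  have hder : HasFDerivAt (marginalDensity t p) (∫ x₀, F' x x₀) x := by
    refine hasFDerivAt_integral_of_dominated_of_fderiv_le (s := Set.univ) Filter.univ_mem
      (bound := fun x₀ => (t ^ 2)⁻¹ * (((2 * Real.pi * t ^ 2) ^ ((d : ℝ) / 2))⁻¹ * t) * p x₀)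
      (Filter.Eventually.of_forall fun y => ((hK y).mul hpm).aestronglyMeasurable)
      (integrable_transitionDensity_mul t hp x) hF'm.aestronglyMeasurable
      (Filter.Eventually.of_forall fun x₀ y _ => hbound x₀ y) (hp.integrable.const_mul _)
      (Filter.Eventually.of_forall fun x₀ y _ => ?_)
    exact (hasFDerivAt_gaussianDensity _ ht y).mul_const (p x₀)
  have hF'int : Integrable (F' x) :=
    (hp.integrable.const_mul _).mono' hF'm.aestronglyMeasurable
      (Filter.Eventually.of_forall fun x₀ => hbound x₀ x)
  refine ext_inner_right ℝ fun v => ?_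
  rw [score, inner_gradient_left, fderiv.log hder.differentiableAt hm.ne', hder.fderiv,
    smul_apply, ContinuousLinearMap.integral_apply hF'int, condMean,
    smul_comm, real_inner_smul_left, smul_eq_mul]
  congr 1
  rw [← integral_smul, real_inner_comm]
  refine Eq.trans ?_ (integral_inner (hint.smul (-(t ^ 2)⁻¹)) v)
  refine integral_congr_ae (Filter.Eventually.of_forall fun x₀ => ?_)
  simp only [F', smul_apply, Pi.smul_apply, innerSL_apply_apply, inner_smul_right,
    smul_eq_mul, real_inner_comm v]
  ring

theorem integrable_smul_score (ht : 0 < t) (hp : IsProbDensity p) (x : E d)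
    (h : ∫⁻ x₀, ‖score p x₀‖ₑ * ENNReal.ofReal (posteriorDensity t p x₀ x) < ∞) :
    Integrable fun x₀ => (transitionDensity t x x₀ * p x₀) • score p x₀ := by
  have hm := marginalDensity_pos ht hp x
  have hmeas := (measurable_posteriorDensity (t := t) hp x).smul (measurable_score p)
  have h1 : Integrable fun x₀ => posteriorDensity t p x₀ x • score p x₀ := by
    refine ⟨hmeas.aestronglyMeasurable, lt_of_eq_of_lt (lintegral_congr fun x₀ => ?_) h⟩
    rw [enorm_smul, mul_comm, Real.enorm_of_nonneg]
    exact div_nonneg (mul_nonneg (transitionDensity_nonneg t x x₀) (hp.nonneg x₀)) hm.le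
  refine (h1.smul (marginalDensity t p x)).congr (Filter.Eventually.of_forall fun x₀ => ?_)
  simp only [Pi.smul_apply, smul_smul, posteriorDensity]
  congr 1
  field_simp

/-- The score of the marginal is the conditional mean of the initial score. -/
theorem score_marginalDensity_eq_condMean_score (ht : t ∈ Ioo (0 : ℝ) 1) (hp : IsProbDensity p)
    (hp1 : ContDiff ℝ 1 p) (x : E d)
    (h : ∫⁻ x₀, ‖score p x₀‖ₑ * ENNReal.ofReal (posteriorDensity t p x₀ x) < ∞) :
    score (marginalDensity t p) x = (1 - t)⁻¹ • condMean t p (fun _ x₀ => score p x₀) x := by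
  have hα : 1 - t ≠ 0 := (sub_pos.2 ht.2).ne'
  have hint := integrable_transitionDensity_mul_smul_sub ht.1 hp x
  have hs := integrable_smul_score ht.1 hp x h
  rw [score_marginalDensity ht.1 hp, condMean, condMean, smul_comm, smul_comm (1 - t)⁻¹]
  congr 1
  rw [eq_inv_smul_iff₀ hα]
  refine ext_inner_right ℝ fun v => ?_
  have e1 : ∀ x₀, inner ℝ ((transitionDensity t x x₀ * p x₀) • score p x₀) v
      = transitionDensity t x x₀ * fderiv ℝ p x₀ v := fun x₀ => by
    rw [real_inner_smul_left, ← mul_inner_score hp hp1, mul_assoc]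
  have e2 : ∀ x₀, inner ℝ ((transitionDensity t x x₀ * p x₀) • (x - (1 - t) • x₀)) v
      * ((1 - t) * (t ^ 2)⁻¹) = fderiv ℝ (fun y => transitionDensity t x y) x₀ v * p x₀ :=
    fun x₀ => by
      rw [(hasFDerivAt_transitionDensity_right ht.1 x x₀).fderiv]
      simp only [smul_apply, innerSL_apply_apply, inner_smul_left,
        smul_eq_mul, conj_trivial]
      ring
  -- The derivative in x₀ moves from the kernel to p, where it becomes p times the score.
  -- Integrability of the three products replaces any decay condition at infinity.
  have ibp := integral_mul_fderiv_eq_neg_fderiv_mul_of_integrable (μ := (volume : Measure (E d)))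
    (f := fun y => transitionDensity t x y) (g := p) (v := v)
    (((hint.inner_const v).mul_const _).congr (Filter.Eventually.of_forall e2))
    ((hs.inner_const v).congr (Filter.Eventually.of_forall e1))
    (integrable_transitionDensity_mul t hp x)
    (fun y _ => (hasFDerivAt_transitionDensity_right ht.1 x y).differentiableAt)
    (fun y _ => hp1.differentiable one_ne_zero y)
  simp_rw [← e1, ← e2] at ibp
  rw [integral_mul_const] at ibp
  simp_rw [real_inner_comm v] at ibp
  rw [integral_inner hint, integral_inner hs] at ibp
  rw [real_inner_comm, real_inner_comm v (∫ x₀, _ • score p x₀), ibp, real_inner_smul_right,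
    real_inner_smul_right]
  ring

/-! ### Bounds on the Fisher information of the marginals -/

theorem le_rpow_inv_of_pow_le {x y : ℝ≥0∞} {n : ℕ} (hn : n ≠ 0) (h : x ^ n ≤ y) :
    x ≤ y ^ (1 / n : ℝ) := by
  rw [one_div, ENNReal.le_rpow_inv_iff (by positivity), ENNReal.rpow_natCast]
  exact h

theorem enorm_add_sq_le {F : Type*} [NormedAddCommGroup F] (a b : F) :
    ‖a + b‖ₑ ^ 2 ≤ 2 * (‖a‖ₑ ^ 2 + ‖b‖ₑ ^ 2) := by
  have := ENNReal.rpow_add_le_mul_rpow_add_rpow ‖a‖ₑ ‖b‖ₑ (p := 2) one_le_two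
  norm_num at this
  exact (pow_le_pow_left' (enorm_add_le a b) 2).trans this

theorem enorm_add_pow_four_le {F : Type*} [NormedAddCommGroup F] (a b : F) :
    ‖a + b‖ₑ ^ 4 ≤ 8 * (‖a‖ₑ ^ 4 + ‖b‖ₑ ^ 4) := by
  have := ENNReal.rpow_add_le_mul_rpow_add_rpow ‖a‖ₑ ‖b‖ₑ (p := (4 : ℕ)) (by norm_num)
  rw [show ((4 : ℕ) : ℝ) - 1 = (3 : ℕ) by norm_num] at this
  simp only [ENNReal.rpow_natCast] at this
  norm_num at this
  exact (pow_le_pow_left' (enorm_add_le a b) 4).trans this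

theorem fisherInfo_eq_lintegral (hp : Measurable p) : fisherInfo p q =
    ∫⁻ x, ‖score p x - score q x‖ₑ ^ 2 ∂(densityMeasure p) := by
  have h1 := measurable_score p
  have h2 := measurable_score q
  rw [lintegral_densityMeasure hp (by fun_prop)]
  exact lintegral_congr fun x => mul_comm _ _

/-- The common shift h cancels. Fourth moments are assumed because the conditional mean under q is
integrated against p_t, and that change of measure doubles the exponent. -/
theorem fisherInfo_marginalDensity_le_of_score_eq (ht : 0 < t) (hp : IsProbDensity p)
    (hq : IsProbDensity q) {f : E d → E d → E d} (hf : Measurable (Function.uncurry f))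
    {A : ℝ≥0∞} (hAp : ∫⁻ y, ‖f y.1 y.2‖ₑ ^ 4 ∂(jointLaw t p) ≤ A)
    (hAq : ∫⁻ y, ‖f y.1 y.2‖ₑ ^ 4 ∂(jointLaw t q) ≤ A) (c : ℝ) (h : E d → E d)
    (hsp : ∀ x, score (marginalDensity t p) x = c • condMean t p f x + h x)
    (hsq : ∀ x, score (marginalDensity t q) x = c • condMean t q f x + h x) :
    fisherInfo (marginalDensity t p) (marginalDensity t q) ≤ ENNReal.ofReal (c ^ 2) *
      (2 * (A ^ (1 / 2 : ℝ) + A ^ (1 / 2 : ℝ) * (2 * (1 + chiDiv 2 p q)) ^ (1 / 2 : ℝ))) := by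
  have := isProbabilityMeasure_jointLaw ht hp
  have hmp := measurable_condMean (t := t) hp hf
  have hmq := measurable_condMean (t := t) hq hf
  have hfm : Measurable fun y : E d × E d => ‖f y.1 y.2‖ₑ ^ 2 := hf.enorm.pow_const 2
  have hP : ∫⁻ x, ‖condMean t p f x‖ₑ ^ 2 ∂(densityMeasure (marginalDensity t p))
      ≤ A ^ (1 / 2 : ℝ) := by
    refine (lintegral_enorm_condMean_pow_le ht hp 1 hf).trans ?_
    refine le_rpow_inv_of_pow_le (n := 2) two_ne_zero ((sq_lintegral_le_lintegral_sq _
      hfm.aemeasurable).trans (le_trans (le_of_eq ?_) hAp))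
    simp_rw [← pow_mul]
  have hQ : ∫⁻ x, ‖condMean t q f x‖ₑ ^ 2 ∂(densityMeasure (marginalDensity t p))
      ≤ A ^ (1 / 2 : ℝ) * (2 * (1 + chiDiv 2 p q)) ^ (1 / 2 : ℝ) := by
    refine (lintegral_marginalDensity_le ht hp hq (hmq.enorm.pow_const 2)).trans ?_
    gcongr
    simp_rw [← pow_mul]
    exact (lintegral_enorm_condMean_pow_le ht hq 2 hf).trans hAq
  rw [fisherInfo_eq_lintegral (measurable_marginalDensity hp)]
  calc ∫⁻ x, ‖score (marginalDensity t p) x - score (marginalDensity t q) x‖ₑ ^ 2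
        ∂(densityMeasure (marginalDensity t p))
      ≤ ∫⁻ x, ENNReal.ofReal (c ^ 2) * (2 * (‖condMean t p f x‖ₑ ^ 2 + ‖condMean t q f x‖ₑ ^ 2))
        ∂(densityMeasure (marginalDensity t p)) := by
        refine lintegral_mono fun x => ?_
        rw [hsp, hsq, add_sub_add_right_eq_sub, ← smul_sub, enorm_smul, mul_pow,
          Real.enorm_eq_ofReal_abs, ← ENNReal.ofReal_pow (abs_nonneg c), sq_abs, sub_eq_add_neg]
        gcongr
        simpa using enorm_add_sq_le (condMean t p f x) (-condMean t q f x)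
    _ ≤ _ := by
        rw [lintegral_const_mul _ (by fun_prop), lintegral_const_mul _ (by fun_prop),
          lintegral_add_left (by fun_prop)]
        gcongr

/-- The rescaled residual is the Gaussian Z itself, whatever p is. -/
theorem lintegral_jointLaw_noise (ht : 0 < t) (hp : IsProbDensity p) :
    ∫⁻ y, ‖t⁻¹ • (y.1 - (1 - t) • y.2)‖ₑ ^ 4 ∂(jointLaw t p)
      = ∫⁻ z, ‖z‖ₑ ^ 4 ∂(stdGaussian (E d)) := by
  rw [lintegral_jointLaw_symm hp (g := fun y => ‖t⁻¹ • (y.1 - (1 - t) • y.2)‖ₑ ^ 4) (by fun_prop)]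
  have h : ∀ x₀ : E d, ∫⁻ x, ENNReal.ofReal (transitionDensity t x x₀) *
      ‖t⁻¹ • (x - (1 - t) • x₀)‖ₑ ^ 4 = ∫⁻ z, ‖z‖ₑ ^ 4 ∂(stdGaussian (E d)) := fun x₀ => by
    rw [lintegral_transitionDensity_mul ht x₀
      (f := fun x => ‖t⁻¹ • (x - (1 - t) • x₀)‖ₑ ^ 4) (by fun_prop)]
    simp [smul_smul, ht.ne']
  dsimp only
  simp_rw [h]
  rw [lintegral_mul_const _ hp.measurable.ennreal_ofReal, hp.lintegral_eq_one, one_mul]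

theorem lintegral_stdGaussian_pow_four_lt_top :
    ∫⁻ z, ‖z‖ₑ ^ 4 ∂(stdGaussian (E d)) < ∞ := by
  have h := (IsGaussian.memLp_id (stdGaussian (E d)) 4 (by norm_num)).eLpNorm_lt_top
  have := lintegral_rpow_enorm_lt_top_of_eLpNorm_lt_top (by norm_num) (by norm_num) h
  norm_num at this
  exact this

theorem condMean_smul (f : E d → E d → E d) (c : ℝ) (x : E d) :
    condMean t p (fun x x₀ => c • f x x₀) x = c • condMean t p f x := by
  simp only [condMean, smul_comm _ c, integral_smul]

theorem score_marginalDensity_eq_condMean_snd (ht : t ∈ Ioo (0 : ℝ) 1) (hp : IsProbDensity p)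
    (x : E d) : score (marginalDensity t p) x
      = ((1 - t) * (t ^ 2)⁻¹) • condMean t p (fun _ x₀ => x₀) x + -(t ^ 2)⁻¹ • x := by
  have hα : 1 - t ≠ 0 := (sub_pos.2 ht.2).ne'
  have hm := marginalDensity_pos ht.1 hp x
  have hx : Integrable fun x₀ => (transitionDensity t x x₀ * p x₀) • x :=
    (integrable_transitionDensity_mul t hp x).smul_const x
  have hi : Integrable fun x₀ => (transitionDensity t x x₀ * p x₀) • ((1 - t) • x₀) := by
    refine (hx.sub (integrable_transitionDensity_mul_smul_sub ht.1 hp x)).congr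
      (Filter.Eventually.of_forall fun x₀ => ?_)
    simp only [Pi.sub_apply]
    rw [← smul_sub, sub_sub_cancel]
  have h : ∫ x₀, (transitionDensity t x x₀ * p x₀) • (x - (1 - t) • x₀) =
      marginalDensity t p x • x - (1 - t) • ∫ x₀, (transitionDensity t x x₀ * p x₀) • x₀ := by
    simp_rw [smul_sub]
    rw [integral_sub hx hi, integral_smul_const, ← marginalDensity, ← integral_smul]
    simp_rw [smul_comm _ (1 - t)]
  rw [score_marginalDensity ht.1 hp, condMean, condMean, h, smul_sub, inv_smul_smul₀ hm.ne',
    smul_sub, smul_comm _ (1 - t), smul_smul _ (1 - t), neg_mul, mul_comm _ (1 - t), neg_smul,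
    neg_smul]
  abel

theorem fisherInfo_marginalDensity_le (ht : t ∈ Ioo (0 : ℝ) 1) (hp : IsProbDensity p)
    (hq : IsProbDensity q) {A : ℝ≥0∞} (hAp : moment 4 p ≤ A) (hAq : moment 4 q ≤ A)
    (hA : ∫⁻ z, ‖z‖ₑ ^ 4 ∂(stdGaussian (E d)) ≤ A) :
    fisherInfo (marginalDensity t p) (marginalDensity t q) ≤
      ENNReal.ofReal (16 * ((1 / t - t) ^ 2 + (1 - t) ^ 2)) *
      (2 * (A ^ (1 / 2 : ℝ) + A ^ (1 / 2 : ℝ) * (2 * (1 + chiDiv 2 p q)) ^ (1 / 2 : ℝ))) := by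
  obtain ⟨ht0, ht1⟩ := ht
  -- For t ≤ 1/2 the noise form has prefactor 1/t, comparable to 1/t - t. For t ≥ 1/2 the X_0 form
  -- has prefactor (1-t)/t², comparable to 1-t.
  rcases le_total t (1 / 2) with hhalf | hhalf
  · have hs : ∀ {r : E d → ℝ}, IsProbDensity r → ∀ x, score (marginalDensity t r) x =
        (-t⁻¹) • condMean t r (fun x x₀ => t⁻¹ • (x - (1 - t) • x₀)) x + 0 := fun {r} hr x => by
      rw [condMean_smul, score_marginalDensity ht0 hr, smul_smul, add_zero]
      congr 1
      field_simp
    refine (fisherInfo_marginalDensity_le_of_score_eq ht0 hp hq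
      (f := fun x x₀ => t⁻¹ • (x - (1 - t) • x₀)) (by unfold Function.uncurry; fun_prop)
      ((lintegral_jointLaw_noise ht0 hp).trans_le hA)
      ((lintegral_jointLaw_noise ht0 hq).trans_le hA) _ (fun _ => 0) (hs hp) (hs hq)).trans ?_
    gcongr
    have h1 : 1 / t - t = (1 - t ^ 2) * t⁻¹ := by field_simp
    have h2 : 0 ≤ (t⁻¹) ^ 2 := by positivity
    have h3 : 1 ≤ 16 * (1 - t ^ 2) ^ 2 := by nlinarith
    rw [h1]
    nlinarith [sq_nonneg (1 - t), mul_le_mul_of_nonneg_right h3 h2]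
  · have hm : ∀ {r : E d → ℝ}, IsProbDensity r →
        ∫⁻ y, ‖y.2‖ₑ ^ 4 ∂(jointLaw t r) = moment 4 r := fun {r} hr => by
      rw [lintegral_jointLaw_snd ht0 hr (g := fun x => ‖x‖ₑ ^ 4) (by fun_prop),
        lintegral_densityMeasure hr.measurable (by fun_prop), moment]
      exact lintegral_congr fun x => mul_comm _ _
    refine (fisherInfo_marginalDensity_le_of_score_eq ht0 hp hq (f := fun _ x₀ => x₀)
      measurable_snd ((hm hp).trans_le hAp) ((hm hq).trans_le hAq) _ _
      (score_marginalDensity_eq_condMean_snd ⟨ht0, ht1⟩ hp)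
      (score_marginalDensity_eq_condMean_snd ⟨ht0, ht1⟩ hq)).trans ?_
    gcongr
    have h1 : t⁻¹ ≤ 2 := by
      rw [inv_le_comm₀ ht0 two_pos]; linarith
    -- This is where the factor 16 comes from; the other regime has room to spare.
    have h2 : (t⁻¹) ^ 4 ≤ 2 ^ 4 := by gcongr
    have h3 : ((1 - t) * (t ^ 2)⁻¹) ^ 2 = (1 - t) ^ 2 * (t⁻¹) ^ 4 := by
      rw [mul_pow, ← inv_pow, ← pow_mul]
    rw [h3]
    nlinarith [sq_nonneg (1 / t - t), mul_le_mul_of_nonneg_left h2 (sq_nonneg (1 - t))]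

/-! ### Comparison with the initial Fisher information -/

/-- The weight is the ratio of the two posterior densities, in which the transition kernel cancels.
Absolute continuity of q with respect to p ensures that no mass of q is lost. -/
theorem score_marginalDensity_sub (ht : t ∈ Ioo (0 : ℝ) 1) (hp : IsProbDensity p)
    (hq : IsProbDensity q) (hp1 : ContDiff ℝ 1 p) (hq1 : ContDiff ℝ 1 q)
    (hac : ∀ᵐ x : E d, p x = 0 → q x = 0) (x : E d)
    (hip : ∫⁻ x₀, ‖score p x₀‖ₑ * ENNReal.ofReal (posteriorDensity t p x₀ x) < ∞)
    (hiq : ∫⁻ x₀, ‖score q x₀‖ₑ * ENNReal.ofReal (posteriorDensity t q x₀ x) < ∞) :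
    score (marginalDensity t p) x - score (marginalDensity t q) x =
      (1 - t)⁻¹ • condMean t p (fun x x₀ => score p x₀ -
        (q x₀ / p x₀ * (marginalDensity t p x / marginalDensity t q x)) • score q x₀) x := by
  have hmp := (marginalDensity_pos ht.1 hp x).ne'
  have hmq := (marginalDensity_pos ht.1 hq x).ne'
  rw [score_marginalDensity_eq_condMean_score ht hp hp1 x hip,
    score_marginalDensity_eq_condMean_score ht hq hq1 x hiq, ← smul_sub]
  congr 1
  have hI := integrable_smul_score ht.1 hp x hip
  have hJ : Integrable fun x₀ => (marginalDensity t p x / marginalDensity t q x) •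
      (transitionDensity t x x₀ * q x₀) • score q x₀ :=
    (integrable_smul_score ht.1 hq x hiq).smul (marginalDensity t p x / marginalDensity t q x)
  have h1 : ∫ x₀, (transitionDensity t x x₀ * p x₀) • (score p x₀ -
        (q x₀ / p x₀ * (marginalDensity t p x / marginalDensity t q x)) • score q x₀) =
      (∫ x₀, (transitionDensity t x x₀ * p x₀) • score p x₀) -
        (marginalDensity t p x / marginalDensity t q x) •
          ∫ x₀, (transitionDensity t x x₀ * q x₀) • score q x₀ := by
    rw [← integral_smul, ← integral_sub hI hJ]
    refine integral_congr_ae ?_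
    filter_upwards [hac] with x₀ hx₀
    rw [smul_sub, smul_smul, smul_smul]
    congr 2
    by_cases h0 : p x₀ = 0
    · simp [h0, hx₀ h0]
    · field_simp
  rw [condMean, condMean, condMean, h1, smul_sub, smul_smul _ (_ / _)]
  congr 2
  field_simp

/-- With r = q/p at X_0 and R = p_t/q_t at X_t, use 1 - rR = (1 - r) + r(1 - R). Jensen raises the
exponent of the first summand from 4 to 16; Cauchy-Schwarz separates the factors of the second. -/
theorem lintegral_jointLaw_weight_le (ht : 0 < t) (hp : IsProbDensity p)
    (hq : IsProbDensity q) (hac : ∀ᵐ x : E d, p x = 0 → q x = 0) :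
    ∫⁻ y, ‖1 - q y.2 / p y.2 * (marginalDensity t p y.1 / marginalDensity t q y.1)‖ₑ ^ 4
        ∂(jointLaw t p) ≤
      8 * (chiDiv 16 q p ^ (1 / 4 : ℝ) + (2 ^ 7 * (1 + chiDiv 8 q p)) ^ (1 / 2 : ℝ) *
        (chiDiv 16 p q ^ (1 / 2 : ℝ) * (2 * (1 + chiDiv 2 p q)) ^ (1 / 2 : ℝ)) ^ (1 / 2 : ℝ)) := by
  have hP := isProbDensity_marginalDensity ht hp
  have hQ := isProbDensity_marginalDensity ht hq
  have hPm := hP.measurable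
  have hQm := hQ.measurable
  have hpm := hp.measurable
  have hqm := hq.measurable
  have := hp.isProbabilityMeasure
  have h1 : ∫⁻ y, ‖1 - q y.2 / p y.2‖ₑ ^ 4 ∂(jointLaw t p) ≤ chiDiv 16 q p ^ (1 / 4 : ℝ) := by
    rw [lintegral_jointLaw_snd ht hp (g := fun x => ‖1 - q x / p x‖ₑ ^ 4) (by fun_prop)]
    refine le_rpow_inv_of_pow_le (n := 4) four_ne_zero
      ((lintegral_pow_le_lintegral_pow _ 2 (by fun_prop)).trans (le_of_eq ?_))
    have := chiDiv_eq_lintegral 16 hq hp hac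
    rw [show ((16 : ℕ) : ℝ) = 16 by norm_num] at this
    rw [this]
    simp_rw [← pow_mul]
    rfl
  have h2 : ∫⁻ y, (‖q y.2 / p y.2‖ₑ ^ 4) ^ 2 ∂(jointLaw t p) ≤ 2 ^ 7 * (1 + chiDiv 8 q p) := by
    rw [lintegral_jointLaw_snd ht hp (g := fun x => (‖q x / p x‖ₑ ^ 4) ^ 2) (by fun_prop)]
    have := lintegral_enorm_div_pow_le 7 hq hp hac
    rw [show ((7 + 1 : ℕ) : ℝ) = 8 by norm_num] at this
    simp_rw [← pow_mul]
    exact this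
  -- The integral is over p_t, while χ_16(p_t|q_t) is an integral over q_t: the change of measure
  -- turns exponent 8 into 16, and data processing returns to time 0.
  have h3 : ∫⁻ y, (‖1 - marginalDensity t p y.1 / marginalDensity t q y.1‖ₑ ^ 4) ^ 2
      ∂(jointLaw t p) ≤ chiDiv 16 p q ^ (1 / 2 : ℝ) *
        (2 * (1 + chiDiv 2 p q)) ^ (1 / 2 : ℝ) := by
    rw [lintegral_jointLaw_fst hp (g := fun x =>
      (‖1 - marginalDensity t p x / marginalDensity t q x‖ₑ ^ 4) ^ 2) (by fun_prop)]
    refine (lintegral_marginalDensity_le ht hp hq (by fun_prop)).trans ?_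
    gcongr
    have e := chiDiv_eq_lintegral_of_pos 16 hP hQ (marginalDensity_pos ht hq)
    have l := chiDiv_marginalDensity_le ht 4 hp hq
    rw [show ((16 : ℕ) : ℝ) = 16 by norm_num] at e
    rw [show ((2 ^ 4 : ℕ) : ℝ) = 16 by norm_num, e] at l
    simp_rw [← pow_mul]
    exact l
  calc ∫⁻ y, ‖1 - q y.2 / p y.2 * (marginalDensity t p y.1 / marginalDensity t q y.1)‖ₑ ^ 4
        ∂(jointLaw t p)
      ≤ ∫⁻ y, 8 * (‖1 - q y.2 / p y.2‖ₑ ^ 4 + ‖q y.2 / p y.2‖ₑ ^ 4 *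
          ‖1 - marginalDensity t p y.1 / marginalDensity t q y.1‖ₑ ^ 4) ∂(jointLaw t p) := by
        refine lintegral_mono fun y => ?_
        rw [← mul_pow, ← enorm_mul]
        refine le_trans (le_of_eq ?_) (enorm_add_pow_four_le _ _)
        congr 2
        ring
    _ = 8 * (∫⁻ y, ‖1 - q y.2 / p y.2‖ₑ ^ 4 ∂(jointLaw t p) + ∫⁻ y, ‖q y.2 / p y.2‖ₑ ^ 4 *
          ‖1 - marginalDensity t p y.1 / marginalDensity t q y.1‖ₑ ^ 4 ∂(jointLaw t p)) := by
        rw [lintegral_const_mul _ (by fun_prop), lintegral_add_left (by fun_prop)]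
    _ ≤ _ := by
        gcongr
        refine (lintegral_mul_le_sqrt_mul_sqrt _ (by fun_prop) (by fun_prop)).trans ?_
        gcongr

theorem fisherInfo_marginalDensity_le_of_score (ht : t ∈ Ioo (0 : ℝ) 1) (hp : IsProbDensity p)
    (hq : IsProbDensity q) (hp1 : ContDiff ℝ 1 p) (hq1 : ContDiff ℝ 1 q)
    (hac : ∀ᵐ x : E d, p x = 0 → q x = 0)
    (hip : ∀ x, ∫⁻ x₀, ‖score p x₀‖ₑ * ENNReal.ofReal (posteriorDensity t p x₀ x) < ∞)
    (hiq : ∀ x, ∫⁻ x₀, ‖score q x₀‖ₑ * ENNReal.ofReal (posteriorDensity t q x₀ x) < ∞) :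
    fisherInfo (marginalDensity t p) (marginalDensity t q) ≤ ENNReal.ofReal (1 / (1 - t) ^ 2) *
      (2 * (fisherInfo p q + (8 * (chiDiv 16 q p ^ (1 / 4 : ℝ) +
        (2 ^ 7 * (1 + chiDiv 8 q p)) ^ (1 / 2 : ℝ) * (chiDiv 16 p q ^ (1 / 2 : ℝ) *
          (2 * (1 + chiDiv 2 p q)) ^ (1 / 2 : ℝ)) ^ (1 / 2 : ℝ))) ^ (1 / 2 : ℝ) *
            scoreMoment 4 q p ^ (1 / 2 : ℝ))) := by
  have hP := isProbDensity_marginalDensity ht.1 hp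
  have hQ := isProbDensity_marginalDensity ht.1 hq
  have hPm := hP.measurable
  have hQm := hQ.measurable
  have hpm := hp.measurable
  have hqm := hq.measurable
  have hsp := measurable_score p
  have hsq := measurable_score q
  have hα : 0 < 1 - t := sub_pos.2 ht.2
  let w : E d → E d → ℝ := fun x x₀ =>
    q x₀ / p x₀ * (marginalDensity t p x / marginalDensity t q x)
  have hw : Measurable fun y : E d × E d => w y.1 y.2 := by fun_prop
  let f : E d → E d → E d := fun x x₀ => score p x₀ - w x x₀ • score q x₀
  have hf : Measurable (Function.uncurry f) := by
    unfold Function.uncurry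
    exact (hsp.comp measurable_snd).sub (hw.smul (hsq.comp measurable_snd))
  have hfd : Measurable fun y : E d × E d => ‖score p y.2 - score q y.2‖ₑ ^ 2 := by fun_prop
  have h1 : ∫⁻ y, ‖score p y.2 - score q y.2‖ₑ ^ 2 ∂(jointLaw t p) = fisherInfo p q := by
    rw [lintegral_jointLaw_snd ht.1 hp (g := fun x => ‖score p x - score q x‖ₑ ^ 2) (by fun_prop),
      fisherInfo_eq_lintegral hpm]
  have h2 : ∫⁻ y, (‖score q y.2‖ₑ ^ 2) ^ 2 ∂(jointLaw t p) = scoreMoment 4 q p := by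
    rw [lintegral_jointLaw_snd ht.1 hp (g := fun x => (‖score q x‖ₑ ^ 2) ^ 2) (by fun_prop),
      lintegral_densityMeasure hpm (by fun_prop), scoreMoment]
    refine lintegral_congr fun x => ?_
    rw [← pow_mul, mul_comm]
  rw [fisherInfo_eq_lintegral hPm]
  calc ∫⁻ x, ‖score (marginalDensity t p) x - score (marginalDensity t q) x‖ₑ ^ 2
        ∂(densityMeasure (marginalDensity t p))
      = ENNReal.ofReal (1 / (1 - t) ^ 2) * ∫⁻ x, ‖condMean t p f x‖ₑ ^ 2
        ∂(densityMeasure (marginalDensity t p)) := by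
        rw [← lintegral_const_mul' _ _ ENNReal.ofReal_ne_top]
        refine lintegral_congr fun x => ?_
        rw [score_marginalDensity_sub ht hp hq hp1 hq1 hac x (hip x) (hiq x), enorm_smul, mul_pow,
          Real.enorm_of_nonneg (by positivity), ← ENNReal.ofReal_pow (by positivity), one_div,
          inv_pow]
    _ ≤ ENNReal.ofReal (1 / (1 - t) ^ 2) * ∫⁻ y, ‖f y.1 y.2‖ₑ ^ 2 ∂(jointLaw t p) := by
        gcongr
        exact lintegral_enorm_condMean_pow_le ht.1 hp 1 hf
    -- The splitting s_p - w s_q = (s_p - s_q) + (1 - w) s_q isolates the initial Fisher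
    -- information.
    _ ≤ ENNReal.ofReal (1 / (1 - t) ^ 2) * ∫⁻ y, 2 * (‖score p y.2 - score q y.2‖ₑ ^ 2 +
          ‖1 - w y.1 y.2‖ₑ ^ 2 * ‖score q y.2‖ₑ ^ 2) ∂(jointLaw t p) := by
        gcongr with y
        rw [← mul_pow, ← enorm_smul]
        refine le_trans (le_of_eq ?_) (enorm_add_sq_le _ _)
        congr 2
        simp only [f, sub_smul, one_smul]
        abel
    _ = ENNReal.ofReal (1 / (1 - t) ^ 2) * (2 * (fisherInfo p q +
          ∫⁻ y, ‖1 - w y.1 y.2‖ₑ ^ 2 * ‖score q y.2‖ₑ ^ 2 ∂(jointLaw t p))) := by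
        rw [lintegral_const_mul _ (by fun_prop), lintegral_add_left hfd, h1]
    _ ≤ _ := by
        gcongr
        refine (lintegral_mul_le_sqrt_mul_sqrt _ (by fun_prop) (by fun_prop)).trans ?_
        rw [h2]
        gcongr
        simp_rw [← pow_mul]
        exact lintegral_jointLaw_weight_le ht.1 hp hq hac

/-- By Jensen χ_8² ≤ χ_16. Hence an infinite χ_8 makes the second bound trivial, and the constant
need not depend on it. -/
theorem chiDiv_sixteen_eq_top (hp : IsProbDensity p) (hq : IsProbDensity q)
    (h : chiDiv 8 p q = ∞) : chiDiv 16 p q = ∞ := by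
  by_contra h16
  have hpm := hp.measurable
  have hqm := hq.measurable
  have := hq.isProbabilityMeasure
  have hac := ae_eq_zero_of_chiDiv_ne_top hp hq h16
  have e8 := chiDiv_eq_lintegral 8 hp hq hac
  have e16 := chiDiv_eq_lintegral 16 hp hq hac
  rw [show ((8 : ℕ) : ℝ) = 8 by norm_num] at e8
  rw [show ((16 : ℕ) : ℝ) = 16 by norm_num] at e16
  have hle := sq_lintegral_le_lintegral_sq (densityMeasure q)
    (f := fun x => ‖1 - p x / q x‖ₑ ^ 8) (by fun_prop)
  simp_rw [← pow_mul] at hle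
  norm_num at hle
  rw [← e8, ← e16, h] at hle
  simp [h16] at hle

/-- Subadditivity of the square root; it halves the exponents 1/4 of a and b to the 1/8 of the final
estimate. -/
theorem sqrt_add_mul_le (K a b : ℝ≥0∞) :
    (8 * (a ^ (1 / 4 : ℝ) + K * (b ^ (1 / 2 : ℝ) * K) ^ (1 / 2 : ℝ))) ^ (1 / 2 : ℝ) ≤
      8 ^ (1 / 2 : ℝ) * (1 + (K * K ^ (1 / 2 : ℝ)) ^ (1 / 2 : ℝ)) *
        (a ^ (1 / 8 : ℝ) + b ^ (1 / 8 : ℝ)) := by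
  have h0 : (0 : ℝ) ≤ 1 / 2 := by norm_num
  rw [ENNReal.mul_rpow_of_nonneg _ _ h0, ENNReal.mul_rpow_of_nonneg _ _ h0, mul_assoc]
  gcongr
  refine (ENNReal.rpow_add_le_add_rpow _ _ h0 (by norm_num)).trans ?_
  rw [← ENNReal.rpow_mul, ← ENNReal.rpow_mul,
    show b ^ (1 / 2 * (1 / 2) : ℝ) = b ^ (1 / 4 : ℝ) by norm_num, mul_left_comm,
    ENNReal.mul_rpow_of_nonneg _ _ h0, ← ENNReal.rpow_mul,
    show (1 / 4 * (1 / 2) : ℝ) = 1 / 8 by norm_num, add_mul, one_mul, mul_comm (b ^ _)]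
  gcongr
  · exact le_self_add
  · exact le_add_self

end Noising

end

/-! ### Choice of the constant and conclusion -/

theorem mainTheorem3 (d : ℕ) (M : ℝ≥0) :
    ∃ C : ℝ≥0, ∀ p : Fin 2 → Noising.E d → ℝ,
      (∀ i, Noising.IsProbDensity (p i)) →
      (∀ i, ContDiff ℝ 1 (p i)) →
      (∀ i, ∀ t ∈ Ioc (0 : ℝ) 1, ∀ x,
        ∫⁻ x₀, ‖Noising.score (p i) x₀‖ₑ *
          ENNReal.ofReal (Noising.posteriorDensity t (p i) x₀ x) < ∞) →
      (∀ i, Noising.scoreMoment 4 (p i) (p 0) ≤ M) →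
      (∀ i, Noising.moment 4 (p i) ≤ M) →
      Noising.chiDiv 2 (p 0) (p 1) ≤ M →
      (Noising.chiDiv 8 (p 1) (p 0) ≤ M ∨ Noising.chiDiv 8 (p 1) (p 0) = ∞) →
      ∀ t ∈ Ioo (0 : ℝ) 1,
        Noising.fisherInfo (Noising.marginalDensity t (p 0))
            (Noising.marginalDensity t (p 1)) ≤
          C * min (ENNReal.ofReal ((1 / t - t) ^ 2 + (1 - t) ^ 2))
            (ENNReal.ofReal (1 / (1 - t) ^ 2) *
              (Noising.fisherInfo (p 0) (p 1)
                + Noising.chiDiv 16 (p 1) (p 0) ^ (1 / 8 : ℝ)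
                + Noising.chiDiv 16 (p 0) (p 1) ^ (1 / 8 : ℝ))) := by
  let A : ℝ≥0∞ := M + ∫⁻ z, ‖z‖ₑ ^ 4 ∂(stdGaussian (Noising.E d))
  let C₁ : ℝ≥0∞ := 16 * (2 * (A ^ (1 / 2 : ℝ) + A ^ (1 / 2 : ℝ) * (2 * (1 + M)) ^ (1 / 2 : ℝ)))
  -- One K dominates both the χ_8 factor and the smaller χ_2 factor.
  let K : ℝ≥0∞ := (2 ^ 7 * (1 + M)) ^ (1 / 2 : ℝ)
  let D : ℝ≥0∞ := 8 ^ (1 / 2 : ℝ) * (1 + (K * K ^ (1 / 2 : ℝ)) ^ (1 / 2 : ℝ)) * M ^ (1 / 2 : ℝ)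
  let C₂ : ℝ≥0∞ := 2 * (1 + D)
  have hA : A ≠ ∞ :=
    ENNReal.add_ne_top.2 ⟨ENNReal.coe_ne_top, Noising.lintegral_stdGaussian_pow_four_lt_top.ne⟩
  have hM1 : (1 + M : ℝ≥0∞) ≠ ∞ := by simp
  have hsqrt : ∀ {x : ℝ≥0∞}, x ≠ ∞ → x ^ (1 / 2 : ℝ) ≠ ∞ := fun hx =>
    ENNReal.rpow_ne_top_of_nonneg (by norm_num) hx
  have hC₁ : C₁ ≠ ∞ := by
    refine ENNReal.mul_ne_top (by norm_num) (ENNReal.mul_ne_top (by norm_num)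
      (ENNReal.add_ne_top.2 ⟨hsqrt hA, ENNReal.mul_ne_top (hsqrt hA) (hsqrt ?_)⟩))
    exact ENNReal.mul_ne_top (by norm_num) hM1
  have hK : K ≠ ∞ := hsqrt (ENNReal.mul_ne_top (by norm_num) hM1)
  have hD : D ≠ ∞ := by
    refine ENNReal.mul_ne_top (ENNReal.mul_ne_top (hsqrt (by norm_num)) ?_)
      (hsqrt ENNReal.coe_ne_top)
    exact ENNReal.add_ne_top.2 ⟨ENNReal.one_ne_top, hsqrt (ENNReal.mul_ne_top hK (hsqrt hK))⟩
  have hC₂ : C₂ ≠ ∞ :=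
    ENNReal.mul_ne_top (by norm_num) (ENNReal.add_ne_top.2 ⟨ENNReal.one_ne_top, hD⟩)
  refine ⟨(C₁ + C₂).toNNReal, fun p hp hp1 hi hs hm h2 h8 t ht => ?_⟩
  rw [ENNReal.coe_toNNReal (ENNReal.add_ne_top.2 ⟨hC₁, hC₂⟩)]
  have hα : 0 < 1 - t := sub_pos.2 ht.2
  have htc : t ∈ Ioc (0 : ℝ) 1 := ⟨ht.1, ht.2.le⟩
  have bound₁ : Noising.fisherInfo (Noising.marginalDensity t (p 0))
      (Noising.marginalDensity t (p 1)) ≤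
      (C₁ + C₂) * ENNReal.ofReal ((1 / t - t) ^ 2 + (1 - t) ^ 2) := by
    refine (Noising.fisherInfo_marginalDensity_le ht (hp 0) (hp 1) (A := A)
      ((hm 0).trans le_self_add) ((hm 1).trans le_self_add) le_add_self).trans ?_
    rw [ENNReal.ofReal_mul (by norm_num), mul_comm (ENNReal.ofReal 16), mul_assoc,
      mul_comm (C₁ + C₂)]
    gcongr
    refine le_trans ?_ (le_self_add (a := C₁))
    simp only [C₁, ENNReal.ofReal_ofNat]
    gcongr
  have bound₂ : Noising.fisherInfo (Noising.marginalDensity t (p 0))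
      (Noising.marginalDensity t (p 1)) ≤
      (C₁ + C₂) * (ENNReal.ofReal (1 / (1 - t) ^ 2) * (Noising.fisherInfo (p 0) (p 1)
        + Noising.chiDiv 16 (p 1) (p 0) ^ (1 / 8 : ℝ)
        + Noising.chiDiv 16 (p 0) (p 1) ^ (1 / 8 : ℝ))) := by
    -- If this divergence is infinite, so is the right side, since C₂ and 1/(1-t)² are positive. If
    -- it is finite, it supplies both the absolute continuity and the bound on χ_8.
    by_cases h16 : Noising.chiDiv 16 (p 1) (p 0) = ∞
    · have hC : C₁ + C₂ ≠ 0 := by simp [C₂]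
      have hpos : ENNReal.ofReal (1 / (1 - t) ^ 2) ≠ 0 := by
        rw [ne_eq, ENNReal.ofReal_eq_zero, not_le]; positivity
      rw [h16, ENNReal.top_rpow_of_pos (by norm_num), add_top, top_add, ENNReal.mul_top hpos,
        ENNReal.mul_top hC]
      exact le_top
    have h8' : Noising.chiDiv 8 (p 1) (p 0) ≤ M := h8.resolve_right fun h =>
      h16 (Noising.chiDiv_sixteen_eq_top (hp 1) (hp 0) h)
    refine (Noising.fisherInfo_marginalDensity_le_of_score ht (hp 0) (hp 1) (hp1 0) (hp1 1)
      (Noising.ae_eq_zero_of_chiDiv_ne_top (hp 1) (hp 0) h16) (hi 0 t htc) (hi 1 t htc)).trans ?_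
    rw [mul_left_comm (C₁ + C₂)]
    refine mul_le_mul' le_rfl ?_
    set FI := Noising.fisherInfo (p 0) (p 1)
    set a := Noising.chiDiv 16 (p 1) (p 0)
    set b := Noising.chiDiv 16 (p 0) (p 1)
    have hK8 : (2 ^ 7 * (1 + Noising.chiDiv 8 (p 1) (p 0))) ^ (1 / 2 : ℝ) ≤ K := by
      simp only [K]; gcongr
    have hK2 : (2 * (1 + Noising.chiDiv 2 (p 0) (p 1))) ^ (1 / 2 : ℝ) ≤ K := by
      simp only [K]
      gcongr
      norm_num
    calc _ ≤ 2 * (FI + (8 * (a ^ (1 / 4 : ℝ) + K * (b ^ (1 / 2 : ℝ) * K) ^ (1 / 2 : ℝ)))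
          ^ (1 / 2 : ℝ) * M ^ (1 / 2 : ℝ)) := by
          gcongr
          exact hs 1
      _ ≤ 2 * (FI + 8 ^ (1 / 2 : ℝ) * (1 + (K * K ^ (1 / 2 : ℝ)) ^ (1 / 2 : ℝ)) *
          (a ^ (1 / 8 : ℝ) + b ^ (1 / 8 : ℝ)) * M ^ (1 / 2 : ℝ)) := by
          gcongr
          exact Noising.sqrt_add_mul_le K a b
      _ = 2 * (1 * FI + D * (a ^ (1 / 8 : ℝ) + b ^ (1 / 8 : ℝ))) := by
          simp only [D]; ring
      _ ≤ 2 * ((1 + D) * FI + (1 + D) * (a ^ (1 / 8 : ℝ) + b ^ (1 / 8 : ℝ))) := by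
          gcongr
          · exact le_self_add
          · exact le_add_self
      _ = C₂ * (FI + a ^ (1 / 8 : ℝ) + b ^ (1 / 8 : ℝ)) := by simp only [C₂]; ring
      _ ≤ _ := by gcongr; exact le_add_self
  rcases min_cases (ENNReal.ofReal ((1 / t - t) ^ 2 + (1 - t) ^ 2))
    (ENNReal.ofReal (1 / (1 - t) ^ 2) * (Noising.fisherInfo (p 0) (p 1)
      + Noising.chiDiv 16 (p 1) (p 0) ^ (1 / 8 : ℝ)
      + Noising.chiDiv 16 (p 0) (p 1) ^ (1 / 8 : ℝ))) with h | h
  · rw [h.1]; exact bound₁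
  · rw [h.1]; exact bound₂
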